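/- All linear spaces and algebras are complex. For a Banach space $X$, let $\mathcal{B}(X)$ be the Banach algebra of continuous linear operators on $X$, let $\mathcal{F}(X)\subseteq\mathcal{B}(X)$ be the set of finite-rank operators, and let $\mathcal{A}(X)$, the algebra of approximable operators, be the closure of $\mathcal{F}(X)$ in $\mathcal{B}(X)$ in the operator norm. A map $P\colon V\to W$ between linear spaces is an $n$-homogeneous polynomial if there is an $n$-linear map $\varphi\colon V^n\to W$ with $P(v)=\varphi(v,\dots,v)$ for all $v\in V$. A Banach space $E$ has the bounded approximation property if there is a constant $C$ such that for every compact set $K\subseteq E$ and every $\varepsilon>0$ there is $T\in\mathcal{F}(E)$ with $\|T\|\le C$ and $\|Tx-x\|<\varepsilon$ for all $x\in K$. **Theorem.** Let $X$ and $Y$ be Banach spaces, let $n\ge 1$ be an integer, and let $P\colon\mathcal{A}(X)\to Y$ be a continuous $n$-homogeneous polynomial. Suppose that the dual space $X^*$ has the bounded approximation property. Then the following conditions are equivalent: 1. $P$ is orthogonally additive, i.e., $P(S+T)=P(S)+P(T)$ whenever $S,T\in\mathcal{A}(X)$ are such that $ST=TS=0$; 2. $P$ is orthogonally additive on $\mathcal{F}(X)$,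 i.e., $P(S+T)=P(S)+P(T)$ whenever $S,T\in\mathcal{F}(X)$ are such that $ST=TS=0$; 3. there exists a unique continuous linear map $\Phi\colon\mathcal{A}(X)\to Y$ such that $P(T)=\Phi(T^n)$ for each $T\in\mathcal{A}(X)$. -/

import Mathlib

/-- A map `P` is an `n`-homogeneous polynomial if it is the restriction to the diagonal of
an `n`-linear map. -/
def IsHomogeneousPolynomial {V W : Type*} [AddCommGroup V] [Module ℂ V] [AddCommGroup W]
    [Module ℂ W] (n : ℕ) (P : V → W) : Prop :=
  ∃ φ : MultilinearMap ℂ (fun _ : Fin n => V) W, ∀ v, P v = φ (fun _ => v)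

/-- `P` is orthogonally additive on the subset `s` of its domain. -/
def OrthogonallyAdditiveOn {A W : Type*} [NonUnitalRing A] [AddCommGroup W]
    (P : A → W) (s : Set A) : Prop :=
  ∀ a ∈ s, ∀ b ∈ s, a * b = 0 → b * a = 0 → P (a + b) = P a + P b

/-- `P` is orthogonally additive. -/
def OrthogonallyAdditive {A W : Type*} [NonUnitalRing A] [AddCommGroup W]
    (P : A → W) : Prop :=
  ∀ a b : A, a * b = 0 → b * a = 0 → P (a + b) = P a + P b

/-- The algebra of continuous finite-rank operators on `X`. -/
noncomputable def finiteRankOperators (X : Type*) [NormedAddCommGroup X] [NormedSpace ℂ X] :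
    NonUnitalSubalgebra ℂ (X →L[ℂ] X) where
  carrier := {T | FiniteDimensional ℂ (LinearMap.range (T : X →ₗ[ℂ] X))}
  add_mem' := by
    intro S T hS hT
    rw [Set.mem_ofPred_eq] at hS hT ⊢
    have h : LinearMap.range ((S + T : X →L[ℂ] X) : X →ₗ[ℂ] X) ≤
        LinearMap.range (S : X →ₗ[ℂ] X) ⊔ LinearMap.range (T : X →ₗ[ℂ] X) := by
      rintro _ ⟨x, rfl⟩
      exact Submodule.add_mem_sup ⟨x, rfl⟩ ⟨x, rfl⟩
    exact Submodule.finiteDimensional_of_le h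
  zero_mem' := by
    have h : LinearMap.range ((0 : X →L[ℂ] X) : X →ₗ[ℂ] X) = ⊥ := LinearMap.range_zero
    rw [Set.mem_ofPred_eq, h]
    infer_instance
  mul_mem' := by
    intro S T hS _
    rw [Set.mem_ofPred_eq] at hS ⊢
    have h : LinearMap.range ((S * T : X →L[ℂ] X) : X →ₗ[ℂ] X) ≤
        LinearMap.range (S : X →ₗ[ℂ] X) := by
      rintro _ ⟨x, rfl⟩
      exact ⟨T x, rfl⟩
    exact Submodule.finiteDimensional_of_le h
  smul_mem' := by
    intro c T hT
    rw [Set.mem_ofPred_eq] at hT ⊢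
    have h : LinearMap.range ((c • T : X →L[ℂ] X) : X →ₗ[ℂ] X) ≤
        LinearMap.range (T : X →ₗ[ℂ] X) := by
      rintro _ ⟨x, rfl⟩
      exact ⟨c • x, by simp⟩
    exact Submodule.finiteDimensional_of_le h

/-- The algebra of approximable operators on `X`: the closure of the finite-rank operators
in the operator norm. -/
noncomputable def approximableOperators (X : Type*) [NormedAddCommGroup X] [NormedSpace ℂ X] :
    NonUnitalSubalgebra ℂ (X →L[ℂ] X) :=
  (finiteRankOperators X).topologicalClosure

/-- The finite-rank operators, as a subset of the algebra of approximable operators. -/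
def finiteRankInApproximable (X : Type*) [NormedAddCommGroup X] [NormedSpace ℂ X] :
    Set (approximableOperators X) :=
  {T | (T : X →L[ℂ] X) ∈ finiteRankOperators X}

theorem NonUnitalSubalgebra.pow_mem_of_pos {B : Type*} [Ring B] [Algebra ℂ B]
    (A : NonUnitalSubalgebra ℂ B) {a : B} (ha : a ∈ A) {n : ℕ} (hn : 1 ≤ n) : a ^ n ∈ A := by
  induction n, hn using Nat.le_induction with
  | base => simpa using ha
  | succ k _ ih => rw [pow_succ]; exact A.mul_mem ih ha

/-- The power `T ^ n` (`n ≥ 1`) of an approximable operator, as an approximable operator. -/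
noncomputable def approximablePow {X : Type*} [NormedAddCommGroup X] [NormedSpace ℂ X]
    (n : ℕ) (hn : 1 ≤ n) (T : approximableOperators X) : approximableOperators X :=
  ⟨(T : X →L[ℂ] X) ^ n, (approximableOperators X).pow_mem_of_pos T.2 hn⟩

/-- `E` has the bounded approximation property: for some constant `C`, the identity of `E` can be
approximated uniformly on each compact set by finite-rank operators of norm at most `C`. -/
def HasBoundedApproximationProperty (E : Type*) [NormedAddCommGroup E] [NormedSpace ℂ E] :
    Prop :=
  ∃ C : ℝ, ∀ K : Set E, IsCompact K → ∀ ε > (0 : ℝ),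
    ∃ T ∈ finiteRankOperators E, ‖T‖ ≤ C ∧ ∀ x ∈ K, ‖T x - x‖ < ε

/-! ### Restricting the diagonal of a multilinear map to complex lines -/

section Polynomials

variable {V Y : Type*} [AddCommGroup V] [Module ℂ V] [NormedAddCommGroup Y] [NormedSpace ℂ Y]

/-! The substance is 2 → 3; write `P` as the diagonal of `φ`. On a full matrix algebra, the
derivative `D` of `P` at `1` satisfies `D p = n P(p)` for every idempotent `p`, since `1 + t p = (1
+ t) p + (1 - p)` is an orthogonal splitting. The spectral theorem gives `n P(A) = D (A ^ n)` for
Hermitian `A`, and analytic continuation gives it for all `A`.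

Any finitely many finite-rank operators lie in a copy of a matrix algebra
(`exists_matrix_embedding`). There the derivative of `P` at `e` in direction `T` is the same for
every `e` with `e T = T e = T`, so it defines a linear `Ψ` on the finite-rank operators
(`exists_linear_representation_finiteRank`).

Cauchy's estimate bounds `Ψ T` in terms of the size of `P` on a ball of radius `‖e‖ + 1`. Hence `Ψ`
is continuous once local units can be chosen uniformly bounded
(`HasBoundedApproximationProperty.exists_bounded_local_unit`). This is where the hypothesis on the
dual enters: a Hahn–Banach argument moves bounded approximations of the identity from the dual down
to `X`. Density then extends `Ψ`. Uniqueness follows by differentiating `n`-th powers. -/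

theorem MultilinearMap.apply_add_smul {n : ℕ} (φ : MultilinearMap ℂ (fun _ : Fin n => V) Y)
    (a b : V) (t : ℂ) :
    φ (fun _ => a + t • b) = φ (fun _ => a) + t • φ.linearDeriv (fun _ => a) (fun _ => b) +
      ∑ s : Finset (Fin n) with 2 ≤ s.card,
        t ^ s.card • φ (s.piecewise (fun _ => b) (fun _ => a)) := by
  have h := φ.map_add_eq_map_add_linearDeriv_add (fun _ => a) (t • fun _ => b)
  rw [map_smul] at h
  have e : (fun _ : Fin n => a + t • b) = (fun _ => a) + (t • fun _ => b) := rfl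
  rw [e, h]
  congr 1
  refine Finset.sum_congr rfl fun s _ => ?_
  have := φ.map_piecewise_smul (fun _ => t) (s.piecewise (fun _ => b) (fun _ => a)) s
  rw [Finset.prod_const] at this
  rw [← this]
  congr 1
  ext i
  by_cases hi : i ∈ s <;> simp [hi]

theorem MultilinearMap.differentiable_apply_add_smul {n : ℕ}
    (φ : MultilinearMap ℂ (fun _ : Fin n => V) Y) (a b : V) :
    Differentiable ℂ (fun t : ℂ => φ (fun _ => a + t • b)) := by
  simp only [φ.apply_add_smul]
  fun_prop

theorem MultilinearMap.hasDerivAt_apply_add_smul {n : ℕ}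
    (φ : MultilinearMap ℂ (fun _ : Fin n => V) Y) (a b : V) :
    HasDerivAt (fun t : ℂ => φ (fun _ => a + t • b))
      (φ.linearDeriv (fun _ => a) (fun _ => b)) 0 := by
  simp only [φ.apply_add_smul]
  have h1 : HasDerivAt (fun t : ℂ => φ (fun _ => a) +
      t • φ.linearDeriv (fun _ => a) (fun _ => b))
      (φ.linearDeriv (fun _ => a) (fun _ => b)) 0 := by
    simpa using ((hasDerivAt_id (0 : ℂ)).smul_const
      (φ.linearDeriv (fun _ => a) (fun _ => b))).const_add (φ (fun _ => a))
  have h2 : HasDerivAt (fun t : ℂ => ∑ s : Finset (Fin n) with 2 ≤ s.card,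
      t ^ s.card • φ (s.piecewise (fun _ => b) (fun _ => a))) 0 0 := by
    have : HasDerivAt (fun t : ℂ => ∑ s : Finset (Fin n) with 2 ≤ s.card,
      t ^ s.card • φ (s.piecewise (fun _ => b) (fun _ => a)))
      (∑ s : Finset (Fin n) with 2 ≤ s.card, (0 : Y)) 0 := by
      refine HasDerivAt.fun_sum fun s hs => ?_
      have hs : 2 ≤ s.card := by simpa using hs
      have := (hasDerivAt_pow s.card (0 : ℂ)).smul_const
        (φ (s.piecewise (fun _ => b) (fun _ => a)))
      rwa [zero_pow (by omega), mul_zero, zero_smul] at this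
    simpa using this
  simpa only [add_zero] using h1.fun_add h2

theorem MultilinearMap.apply_diagonal_smul {n : ℕ} (φ : MultilinearMap ℂ (fun _ : Fin n => V) Y)
    (c : ℂ) (v : V) : φ (fun _ => c • v) = c ^ n • φ (fun _ => v) := by
  have := φ.map_smul_univ (fun _ => c) (fun _ => v)
  simpa using this

/-- Identity theorem: the function of `z` is entire, and its real zeros accumulate at `0`. -/
theorem MultilinearMap.apply_add_smul_eq_zero_of_real [CompleteSpace Y] {n : ℕ}
    (φ : MultilinearMap ℂ (fun _ : Fin n => V) Y) (a b : V)
    (h : ∀ t : ℝ, φ (fun _ => a + (t : ℂ) • b) = 0) (z : ℂ) : φ (fun _ => a + z • b) = 0 := by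
  have hd := φ.differentiable_apply_add_smul a b
  have ha : AnalyticOnNhd ℂ (fun t : ℂ => φ (fun _ => a + t • b)) Set.univ :=
    fun z _ => hd.analyticAt z
  have hf : ∃ᶠ t in nhdsWithin (0 : ℂ) {0}ᶜ, φ (fun _ => a + t • b) = (fun _ : ℂ => (0 : Y)) t := by
    have ht : Filter.Tendsto (fun t : ℝ => (t : ℂ)) (nhdsWithin 0 {0}ᶜ) (nhdsWithin 0 {0}ᶜ) := by
      refine tendsto_nhdsWithin_iff.2 ⟨?_, ?_⟩
      · exact (Complex.continuous_ofReal.tendsto' 0 0 (by simp)).mono_left nhdsWithin_le_nhds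
      · filter_upwards [self_mem_nhdsWithin] with t ht
        simpa using ht
    exact ht.frequently (Filter.Frequently.of_forall fun t => h t)
  exact congrFun (ha.eq_of_frequently_eq (fun z _ => analyticAt_const) hf) z

end Polynomials

/-! ### Derivatives at the unit, idempotents and powers -/

section UnitalAlgebra

variable {R Y : Type*} [Ring R] [Algebra ℂ R] [NormedAddCommGroup Y] [NormedSpace ℂ Y]

/-- The linear map `b ↦ d/dt φ(a + t b, …, a + t b)` at `t = 0`. -/
def MultilinearMap.diagonalDeriv {V W : Type*} [AddCommGroup V] [Module ℂ V] [AddCommGroup W]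
    [Module ℂ W] {n : ℕ} (φ : MultilinearMap ℂ (fun _ : Fin n => V) W) (a : V) : V →ₗ[ℂ] W :=
  φ.linearDeriv (fun _ => a) ∘ₗ LinearMap.pi fun _ => LinearMap.id

theorem MultilinearMap.diagonalDeriv_apply {V W : Type*} [AddCommGroup V] [Module ℂ V]
    [AddCommGroup W] [Module ℂ W] {n : ℕ} (φ : MultilinearMap ℂ (fun _ : Fin n => V) W) (a b : V) :
    φ.diagonalDeriv a b = φ.linearDeriv (fun _ => a) (fun _ => b) := rfl

theorem MultilinearMap.diagonalDeriv_idempotent {n : ℕ}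
    (φ : MultilinearMap ℂ (fun _ : Fin n => R) Y)
    (hφ : OrthogonallyAdditive fun a => φ (fun _ => a)) {p : R} (hp : p * p = p) :
    φ.diagonalDeriv 1 p = n • φ (fun _ => p) := by
  have h1 := φ.hasDerivAt_apply_add_smul 1 p
  have h2 : (fun t : ℂ => φ (fun _ => 1 + t • p)) =
      fun t : ℂ => (1 + t) ^ n • φ (fun _ => p) + φ (fun _ => 1 - p) := by
    funext t
    -- The two summands annihilate each other, so orthogonal additivity makes the dependence on `t`
    -- explicit.
    have e : (1 : R) + t • p = (1 + t) • p + (1 - p) := by rw [add_smul, one_smul]; abel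
    rw [e, ← φ.apply_diagonal_smul]
    exact hφ ((1 + t) • p) (1 - p) (by simp [mul_sub, hp]) (by simp [sub_mul, hp])
  rw [h2] at h1
  have h3 : HasDerivAt (fun t : ℂ => (1 + t) ^ n • φ (fun _ => p) + φ (fun _ => 1 - p))
      ((n : ℂ) • φ (fun _ => p)) 0 := by
    have := ((((hasDerivAt_id (0 : ℂ)).const_add 1).fun_pow n).smul_const
      (φ fun _ => p)).add_const (φ (fun _ => 1 - p))
    simpa using this
  rw [diagonalDeriv_apply, h1.unique h3, Nat.cast_smul_eq_nsmul]

theorem sum_smul_orthogonal_idempotents_pow {k : ℕ} (v : Fin k → R) (hv : ∀ i, v i * v i = v i)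
    (hvv : ∀ i j, i ≠ j → v i * v j = 0) (hv1 : ∑ i, v i = 1) (c : Fin k → ℂ) (n : ℕ) :
    (∑ i, c i • v i) ^ n = ∑ i, c i ^ n • v i := by
  induction n with
  | zero => simp [hv1]
  | succ n ih =>
    rw [pow_succ, ih, Finset.sum_mul_sum]
    refine Finset.sum_congr rfl fun i _ => ?_
    rw [Finset.sum_eq_single i]
    · rw [smul_mul_smul_comm, hv, pow_succ]
    · intro j _ hj
      rw [smul_mul_smul_comm, hvv i j hj.symm, smul_zero]
    · simp

theorem MultilinearMap.nsmul_apply_eq_diagonalDeriv_pow_of_orthogonal_idempotents {n : ℕ}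
    (φ : MultilinearMap ℂ (fun _ : Fin n => R) Y)
    (hφ : OrthogonallyAdditive fun a => φ (fun _ => a)) {k : ℕ} (v : Fin k → R)
    (hv : ∀ i, v i * v i = v i) (hvv : ∀ i j, i ≠ j → v i * v j = 0) (hv1 : ∑ i, v i = 1)
    (c : Fin k → ℂ) :
    n • φ (fun _ => ∑ i, c i • v i) = φ.diagonalDeriv 1 ((∑ i, c i • v i) ^ n) := by
  have h0 : φ (fun _ => 0) = 0 := by simpa using hφ 0 0 (by simp) (by simp)
  have hs : ∀ s : Finset (Fin k), φ (fun _ => ∑ i ∈ s, c i • v i) =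
      ∑ i ∈ s, c i ^ n • φ (fun _ => v i) := by
    intro s
    induction s using Finset.induction_on with
    | empty => simpa using h0
    | insert i s hi ih =>
      rw [Finset.sum_insert hi, Finset.sum_insert hi, ← ih, ← φ.apply_diagonal_smul]
      refine hφ _ _ ?_ ?_
      · rw [Finset.mul_sum]
        refine Finset.sum_eq_zero fun j hj => ?_
        rw [smul_mul_smul_comm, hvv i j (by rintro rfl; exact hi hj), smul_zero]
      · rw [Finset.sum_mul]
        refine Finset.sum_eq_zero fun j hj => ?_
        rw [smul_mul_smul_comm, hvv j i (by rintro rfl; exact hi hj), smul_zero]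
  rw [sum_smul_orthogonal_idempotents_pow v hv hvv hv1, hs,
    _root_.map_sum, Finset.smul_sum]
  refine Finset.sum_congr rfl fun i _ => ?_
  rw [_root_.map_smul, φ.diagonalDeriv_idempotent hφ (hv i), smul_comm]

/-- `E` acts as a unit on every monomial containing `S`, so the increment over `E ^ n` is the one
obtained with `1` in place of `E`. Idempotence of `E` is not needed. -/
theorem add_smul_pow_of_absorb {E S : R} (hES : E * S = S) (hSE : S * E = S) (t : ℂ) (n : ℕ) :
    (E + t • S) ^ n = E ^ n + ((1 + t • S) ^ n - 1) := by
  have hE : ∀ n, S * E ^ n = S := by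
    intro n
    induction n with
    | zero => simp
    | succ n ih => rw [pow_succ, ← mul_assoc, ih, hSE]
  have hF : ∀ n, E * ((1 + t • S) ^ n - 1) = (1 + t • S) ^ n - 1 := by
    intro n
    induction n with
    | zero => simp
    | succ n ih =>
      have : (1 + t • S) ^ (n + 1) - 1 = ((1 + t • S) ^ n - 1) + t • (S * (1 + t • S) ^ n) := by
        rw [pow_succ', add_mul, one_mul, smul_mul_assoc]; abel
      rw [this, mul_add, ih, mul_smul_comm, ← mul_assoc, hES]
  induction n with
  | zero => simp
  | succ n ih =>
    rw [pow_succ', ih, pow_succ' (1 + t • S), mul_add, add_mul, add_mul E, hF, smul_mul_assoc,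
      hE, smul_mul_assoc, add_mul, one_mul, mul_sub, mul_one, smul_mul_assoc, pow_succ', smul_sub]
    abel

/-- The binomial expansion makes the curve an explicit polynomial in `t`, so neither a topology on
`R` nor continuity of `D` is required. -/
theorem LinearMap.hasDerivAt_add_smul_pow_of_absorb (D : R →ₗ[ℂ] Y) {E S : R} (hES : E * S = S)
    (hSE : S * E = S) (n : ℕ) :
    HasDerivAt (fun t : ℂ => D ((E + t • S) ^ n)) (n • D S) 0 := by
  have h1 : (fun t : ℂ => D ((E + t • S) ^ n)) =
      fun t : ℂ => D (E ^ n) + (∑ m ∈ Finset.range (n + 1),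
        (t ^ m * (n.choose m : ℂ)) • D (S ^ m) - D 1) := by
    funext t
    rw [add_smul_pow_of_absorb hES hSE, add_comm (1 : R),
      (Commute.one_right (t • S)).add_pow, map_add, map_sub, map_sum]
    congr 3
    funext m
    rw [one_pow, mul_one, smul_pow, ← map_smul]
    congr 1
    rw [mul_smul, smul_mul_assoc, ← nsmul_eq_mul', Nat.cast_smul_eq_nsmul]
  rw [h1]
  have h2 : HasDerivAt (fun t : ℂ => ∑ m ∈ Finset.range (n + 1),
      (t ^ m * (n.choose m : ℂ)) • D (S ^ m))
      (∑ m ∈ Finset.range (n + 1), ((m : ℂ) * 0 ^ (m - 1) * (n.choose m : ℂ)) • D (S ^ m)) 0 :=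
    HasDerivAt.fun_sum fun m _ => ((hasDerivAt_pow m (0 : ℂ)).mul_const _).smul_const _
  have h3 : ∑ m ∈ Finset.range (n + 1), ((m : ℂ) * 0 ^ (m - 1) * (n.choose m : ℂ)) • D (S ^ m) =
      n • D S := by
    rw [Finset.sum_eq_single 1]
    · simp [Nat.cast_smul_eq_nsmul]
    · intro m _ hm
      -- For `m = 0` the truncated exponent gives `0 ^ 0 = 1`; the factor `m` is what kills the
      -- term.
      rcases Nat.eq_zero_or_pos m with rfl | hpos
      · simp
      · rw [zero_pow (by omega)]; simp
    · intro h
      have : n = 0 := by simpa using h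
      simp [this]
  rw [h3] at h2
  exact (h2.sub_const _).const_add _

end UnitalAlgebra

/-! ### Full matrix algebras -/

section Matrices

variable {Y : Type*} [NormedAddCommGroup Y] [NormedSpace ℂ Y]

theorem Matrix.IsHermitian.nsmul_apply_eq_diagonalDeriv_pow {n k : ℕ}
    (φ : MultilinearMap ℂ (fun _ : Fin n => Matrix (Fin k) (Fin k) ℂ) Y)
    (hφ : OrthogonallyAdditive fun a => φ (fun _ => a)) {A : Matrix (Fin k) (Fin k) ℂ}
    (hA : A.IsHermitian) : n • φ (fun _ => A) = φ.diagonalDeriv 1 (A ^ n) := by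
  set f := Unitary.conjStarAlgAut ℂ _ hA.eigenvectorUnitary with hf
  let v : Fin k → Matrix (Fin k) (Fin k) ℂ := fun i => f (Matrix.single i i 1)
  have hAv : A = ∑ i, (hA.eigenvalues i : ℂ) • v i := by
    conv_lhs => rw [hA.spectral_theorem, ← hf]
    simp only [v, ← map_smul, ← map_sum]
    congr 1
    ext i j
    simp [Matrix.sum_apply, Matrix.diagonal_apply, Matrix.single_apply, ite_and]
  have h := φ.nsmul_apply_eq_diagonalDeriv_pow_of_orthogonal_idempotents hφ v ?_ ?_ ?_
    (fun i => (hA.eigenvalues i : ℂ))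
  · rwa [← hAv] at h
  · intro i
    simp [v, ← map_mul]
  · intro i j hij
    simp [v, ← map_mul, hij]
  · simp only [v, ← map_sum]
    rw [← map_one f]
    congr 1
    ext i j
    simp [Matrix.sum_apply, Matrix.one_apply, Matrix.single_apply, ite_and]

/-- Orthogonally additive homogeneous polynomials on a full matrix algebra are linear in the
`n`-th power. -/
theorem MultilinearMap.nsmul_apply_matrix_eq_diagonalDeriv_pow [CompleteSpace Y] {n k : ℕ}
    (φ : MultilinearMap ℂ (fun _ : Fin n => Matrix (Fin k) (Fin k) ℂ) Y)
    (hφ : OrthogonallyAdditive fun a => φ (fun _ => a)) (A : Matrix (Fin k) (Fin k) ℂ) :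
    n • φ (fun _ => A) = φ.diagonalDeriv 1 (A ^ n) := by
  let ψ : MultilinearMap ℂ (fun _ : Fin n => Matrix (Fin k) (Fin k) ℂ) Y :=
    n • φ - (φ.diagonalDeriv 1).compMultilinearMap
      (MultilinearMap.mkPiAlgebraFin ℂ n (Matrix (Fin k) (Fin k) ℂ))
  have hψ : ∀ B, ψ (fun _ => B) = n • φ (fun _ => B) - φ.diagonalDeriv 1 (B ^ n) := by
    intro B
    simp [ψ]
  rw [← sub_eq_zero, ← hψ, ← realPart_add_I_smul_imaginaryPart A]
  -- For real `t` the matrix `Re A + t Im A` is Hermitian; the value `t = i` recovers `A`.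
  refine ψ.apply_add_smul_eq_zero_of_real _ _ (fun t => ?_) Complex.I
  rw [hψ, sub_eq_zero]
  refine Matrix.IsHermitian.nsmul_apply_eq_diagonalDeriv_pow φ hφ ?_
  have h2 : ((t : ℂ) • (imaginaryPart A : Matrix (Fin k) (Fin k) ℂ)).IsHermitian := by
    have : IsSelfAdjoint ((t : ℂ) • (imaginaryPart A : Matrix (Fin k) (Fin k) ℂ)) :=
      IsSelfAdjoint.smul (by simp [isSelfAdjoint_iff]) (imaginaryPart A).2
    exact this
  exact Matrix.IsHermitian.add (realPart A).2 h2

/-- Differentiate `n P(E + t S) = D ((E + t S) ^ n)` at `t = 0`, with `D` the derivative at `1`.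
Non-idempotent `E` must be allowed, because the bounded local units constructed below need not be
idempotent. -/
theorem MultilinearMap.diagonalDeriv_matrix_of_absorb [CompleteSpace Y] {n k : ℕ} (hn : 1 ≤ n)
    (φ : MultilinearMap ℂ (fun _ : Fin n => Matrix (Fin k) (Fin k) ℂ) Y)
    (hφ : OrthogonallyAdditive fun a => φ (fun _ => a)) {E S : Matrix (Fin k) (Fin k) ℂ}
    (hES : E * S = S) (hSE : S * E = S) : φ.diagonalDeriv E S = φ.diagonalDeriv 1 S := by
  have h1 := (φ.hasDerivAt_apply_add_smul E S).const_smul (n : ℂ)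
  have h2 := (φ.diagonalDeriv 1).hasDerivAt_add_smul_pow_of_absorb hES hSE n
  have h3 : (fun t : ℂ => φ.diagonalDeriv 1 ((E + t • S) ^ n)) =
      (n : ℂ) • fun t : ℂ => φ (fun _ => E + t • S) := by
    funext t
    rw [← φ.nsmul_apply_matrix_eq_diagonalDeriv_pow hφ, Pi.smul_apply, Nat.cast_smul_eq_nsmul]
  rw [h3] at h2
  have h4 := h1.unique h2
  rw [← Nat.cast_smul_eq_nsmul ℂ] at h4
  exact smul_right_injective Y (Nat.cast_ne_zero.2 (by omega : n ≠ 0) : (n : ℂ) ≠ 0) h4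

end Matrices

/-! ### Finite-rank operators as matrices -/

section FiniteRank

variable {X Z : Type*} [NormedAddCommGroup X] [NormedSpace ℂ X] [NormedAddCommGroup Z]
  [NormedSpace ℂ Z]

theorem mem_finiteRankOperators_of_range_le {T : X →L[ℂ] X} (W : Submodule ℂ X)
    [FiniteDimensional ℂ W] (h : ∀ x, T x ∈ W) : T ∈ finiteRankOperators X := by
  have hle : LinearMap.range (T : X →ₗ[ℂ] X) ≤ W := by
    rintro _ ⟨x, rfl⟩
    exact h x
  exact Submodule.finiteDimensional_of_le hle

theorem mul_mem_finiteRankOperators_left {T : X →L[ℂ] X} (hT : T ∈ finiteRankOperators X)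
    (S : X →L[ℂ] X) : T * S ∈ finiteRankOperators X := by
  have : FiniteDimensional ℂ (LinearMap.range (T : X →ₗ[ℂ] X)) := hT
  exact mem_finiteRankOperators_of_range_le (LinearMap.range (T : X →ₗ[ℂ] X)) fun x => ⟨S x, rfl⟩

theorem mul_mem_finiteRankOperators_right {T : X →L[ℂ] X} (hT : T ∈ finiteRankOperators X)
    (S : X →L[ℂ] X) : S * T ∈ finiteRankOperators X := by
  have : FiniteDimensional ℂ (LinearMap.range (T : X →ₗ[ℂ] X)) := hT
  exact mem_finiteRankOperators_of_range_le
    ((LinearMap.range (T : X →ₗ[ℂ] X)).map (S : X →ₗ[ℂ] X)) fun x => ⟨T x, ⟨x, rfl⟩, rfl⟩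

theorem exists_finiteRank_right_unit (S : X →L[ℂ] Z)
    [FiniteDimensional ℂ (LinearMap.range (S : X →ₗ[ℂ] Z))] :
    ∃ q ∈ finiteRankOperators X, q * q = q ∧ ∀ x, S (q x) = S x := by
  obtain ⟨r, hr⟩ := (S : X →ₗ[ℂ] Z).rangeRestrict.exists_rightInverse_of_surjective
    (LinearMap.range_rangeRestrict _)
  let S' : X →L[ℂ] LinearMap.range (S : X →ₗ[ℂ] Z) := S.codRestrict _ fun x => ⟨x, rfl⟩
  have hr' : ∀ y, S' (r y) = y := fun y => LinearMap.congr_fun hr y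
  refine ⟨(LinearMap.toContinuousLinearMap r).comp S',
    mem_finiteRankOperators_of_range_le (LinearMap.range r) fun x => ⟨S' x, rfl⟩, ?_, fun x => ?_⟩
  · ext x
    change r (S' (r (S' x))) = r (S' x)
    rw [hr']
  · exact congrArg Subtype.val (hr' (S' x))

theorem exists_finiteRank_projection (W : Submodule ℂ X) [FiniteDimensional ℂ W] :
    ∃ p ∈ finiteRankOperators X, p * p = p ∧ ∀ x ∈ W, p x = x := by
  obtain ⟨f, hf⟩ := Submodule.ClosedComplemented.of_finiteDimensional (𝕜 := ℂ) W
  refine ⟨W.subtypeL.comp f, mem_finiteRankOperators_of_range_le W fun x => (f x).2, ?_,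
    fun x hx => ?_⟩
  · ext x
    change (f (f x) : X) = f x
    rw [hf]
  · exact congrArg Subtype.val (hf ⟨x, hx⟩)

theorem exists_finiteRank_idempotent_unit {ι : Type*} [Finite ι] (T : ι → X →L[ℂ] X)
    (hT : ∀ i, T i ∈ finiteRankOperators X) :
    ∃ e ∈ finiteRankOperators X, e * e = e ∧ ∀ i, e * T i = T i ∧ T i * e = T i := by
  classical
  have := Fintype.ofFinite ι
  have hT' : ∀ i, FiniteDimensional ℂ (LinearMap.range (T i : X →ₗ[ℂ] X)) := hT
  have hfin : FiniteDimensional ℂ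
      (LinearMap.range ((ContinuousLinearMap.pi T : X →L[ℂ] ι → X) : X →ₗ[ℂ] ι → X)) := by
    let g : (∀ i, LinearMap.range (T i : X →ₗ[ℂ] X)) →ₗ[ℂ] ι → X :=
      LinearMap.pi fun i => (LinearMap.range (T i : X →ₗ[ℂ] X)).subtype ∘ₗ LinearMap.proj i
    have hle : LinearMap.range ((ContinuousLinearMap.pi T : X →L[ℂ] ι → X) : X →ₗ[ℂ] ι → X) ≤
        LinearMap.range g := by
      rintro _ ⟨x, rfl⟩
      exact ⟨fun i => ⟨T i x, ⟨x, rfl⟩⟩, rfl⟩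
    exact Submodule.finiteDimensional_of_le hle
  obtain ⟨q, hqF, hqq, hq⟩ := exists_finiteRank_right_unit (ContinuousLinearMap.pi T : X →L[ℂ] ι → X)
  have hTq : ∀ i, T i * q = T i := fun i => by
    ext x
    exact congrFun (hq x) i
  have : FiniteDimensional ℂ (LinearMap.range (q : X →ₗ[ℂ] X)) := hqF
  obtain ⟨p, hpF, hpp, hp⟩ := exists_finiteRank_projection
    ((⨆ i, LinearMap.range (T i : X →ₗ[ℂ] X)) ⊔ LinearMap.range (q : X →ₗ[ℂ] X))
  have hpq : p * q = q := by
    ext x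
    exact hp _ (Submodule.mem_sup_right ⟨x, rfl⟩)
  have hpT : ∀ i, p * T i = T i := fun i => by
    ext x
    exact hp _ (Submodule.mem_sup_left
      (Submodule.mem_iSup_of_mem (p := fun i => LinearMap.range (T i : X →ₗ[ℂ] X)) i ⟨x, rfl⟩))
  -- Here `1 - e = (1 - q)(1 - p)`: `1 - p` kills each `T i` from the left and `1 - q` from the
  -- right. The relation `p q = q` makes `e` idempotent.
  refine ⟨p + q - q * p, sub_mem (add_mem hpF hqF) (mul_mem hqF hpF), ?_, fun i => ⟨?_, ?_⟩⟩
  · have h1 : p * (p + q - q * p) = p + q - q * p := by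
      rw [mul_sub, mul_add, hpp, hpq, ← mul_assoc, hpq]
    have h2 : q * (p + q - q * p) = q := by
      rw [mul_sub, mul_add, hqq, ← mul_assoc, hqq]; abel
    rw [sub_mul, add_mul, mul_assoc q p, h1, h2]
    abel
  · rw [sub_mul, add_mul, mul_assoc, hpT]; abel
  · rw [mul_sub, mul_add, ← mul_assoc, hTq]; abel

/-- Finitely many finite-rank operators lie in the image of a full matrix algebra. -/
theorem exists_matrix_embedding {ι : Type*} [Finite ι] (T : ι → approximableOperators X)
    (hT : ∀ i, T i ∈ finiteRankInApproximable X) :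
    ∃ (k : ℕ) (J : Matrix (Fin k) (Fin k) ℂ →ₙₐ[ℂ] approximableOperators X),
      Function.Injective J ∧ (∀ A, J A ∈ finiteRankInApproximable X) ∧ ∀ i, ∃ A, J A = T i := by
  obtain ⟨e, heF, hee, he⟩ := exists_finiteRank_idempotent_unit (fun i => (T i : X →L[ℂ] X)) hT
  have hfin : FiniteDimensional ℂ (LinearMap.range (e : X →ₗ[ℂ] X)) := heF
  let W := LinearMap.range (e : X →ₗ[ℂ] X)
  let k := Module.finrank ℂ W
  let b : W ≃L[ℂ] (Fin k → ℂ) := (Module.finBasis ℂ W).equivFun.toContinuousLinearEquiv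
  -- `L` and `R` factor `e` through coordinates of its range: `L R = e` and `R L = 1`. Thus `A ↦ L A
  -- R` is multiplicative and injective.
  let L : (Fin k → ℂ) →L[ℂ] X := W.subtypeL.comp (b.symm : (Fin k → ℂ) →L[ℂ] W)
  let R : X →L[ℂ] (Fin k → ℂ) := (b : W →L[ℂ] (Fin k → ℂ)).comp
    (e.codRestrict W fun x => ⟨x, rfl⟩)
  have hLR : ∀ x, L (R x) = e x := fun x => by simp [L, R]; rfl
  have hRL : ∀ c, R (L c) = c := by
    intro c
    have : e.codRestrict W (fun x => ⟨x, rfl⟩) (b.symm c : X) = b.symm c := by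
      obtain ⟨x, hx⟩ := (b.symm c).2
      refine Subtype.ext ?_
      change e (b.symm c : X) = (b.symm c : X)
      rw [← hx]
      exact congrArg (fun S : X →L[ℂ] X => S x) hee
    simp [L, R, this]
  let m : Matrix (Fin k) (Fin k) ℂ → X →L[ℂ] X := fun A =>
    (L.comp (LinearMap.toContinuousLinearMap (Matrix.toLin' A))).comp R
  have hm : ∀ A x, m A x = L (A.mulVec (R x)) := fun A x => rfl
  let J₀ : Matrix (Fin k) (Fin k) ℂ →ₙₐ[ℂ] (X →L[ℂ] X) :=
    { toFun := m
      map_smul' := fun c A => by ext x; simp [hm, Matrix.smul_mulVec]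
      map_zero' := by ext x; simp [hm]
      map_add' := fun A B => by ext x; simp [hm, Matrix.add_mulVec]
      map_mul' := fun A B => by ext x; simp [hm, hRL] }
  have hJ₀ : ∀ A, J₀ A ∈ finiteRankOperators X := fun A =>
    mem_finiteRankOperators_of_range_le W fun x => (b.symm _).2
  refine ⟨k, NonUnitalAlgHom.codRestrict J₀ (approximableOperators X)
    fun A => (finiteRankOperators X).le_topologicalClosure (hJ₀ A),
    fun A B hAB => ?_, hJ₀, fun i => ?_⟩
  · refine Matrix.toLin'.injective (LinearMap.ext fun c => ?_)
    have h := congrArg (fun S : X →L[ℂ] X => R (S (L c))) (congrArg Subtype.val hAB)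
    change R (L (A.mulVec (R (L c)))) = R (L (B.mulVec (R (L c)))) at h
    rwa [hRL, hRL, hRL] at h
  refine ⟨LinearMap.toMatrix' ((R.comp ((T i : X →L[ℂ] X).comp L) :
    (Fin k → ℂ) →L[ℂ] (Fin k → ℂ)) : (Fin k → ℂ) →ₗ[ℂ] (Fin k → ℂ)), Subtype.ext ?_⟩
  change m _ = _
  ext x
  rw [hm, LinearMap.toMatrix'_mulVec]
  change L (R ((T i : X →L[ℂ] X) (L (R x)))) = _
  rw [hLR, hLR]
  have h1 := congrArg (fun S : X →L[ℂ] X => S (e x)) (he i).1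
  have h2 := congrArg (fun S : X →L[ℂ] X => S x) (he i).2
  exact h1.trans h2

end FiniteRank

/-! ### Bounded local units from the approximation property of the dual -/

section ApproximateUnits

variable {X Z : Type*} [NormedAddCommGroup X] [NormedSpace ℂ X] [NormedAddCommGroup Z]
  [NormedSpace ℂ Z]

/-- The image of the unit ball under `q` is totally bounded. If the points `q z` form a `1/2`-net of
it, then `‖T x‖ ≤ M + ‖T‖ / 2` on the unit ball, and the last term is absorbed. -/
theorem exists_finset_norming_of_finiteRank {q : X →L[ℂ] X} (hq : q ∈ finiteRankOperators X) :
    ∃ s : Finset X, (∀ z ∈ s, ‖z‖ ≤ 1) ∧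
      ∀ T : X →L[ℂ] X, T * q = T → ∀ M, (∀ z ∈ s, ‖T z‖ ≤ M) → ‖T‖ ≤ 2 * M := by
  classical
  have hfin : FiniteDimensional ℂ (LinearMap.range (q : X →ₗ[ℂ] X)) := hq
  have : ProperSpace (LinearMap.range (q : X →ₗ[ℂ] X)) := FiniteDimensional.proper ℂ _
  have htb : TotallyBounded (q '' Metric.closedBall 0 1) := by
    let q' : X →L[ℂ] LinearMap.range (q : X →ₗ[ℂ] X) := q.codRestrict _ fun x => ⟨x, rfl⟩
    have h1 : TotallyBounded (q' '' Metric.closedBall 0 1) :=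
      ((q'.lipschitz.isBounded_image Metric.isBounded_closedBall).isCompact_closure.totallyBounded).subset
        subset_closure
    have h2 := h1.image (uniformContinuous_subtype_val (p := fun x => x ∈ LinearMap.range (q : X →ₗ[ℂ] X)))
    rwa [Set.image_image] at h2
  have hnet := Metric.finite_approx_of_totallyBounded htb (1 / 2) (by norm_num)
  rw [Set.exists_subset_image_finite_and] at hnet
  obtain ⟨t, htB, htf, ht⟩ := hnet
  refine ⟨htf.toFinset, fun z hz => by simpa using htB (htf.mem_toFinset.1 hz), fun T hT M hM => ?_⟩
  have key : ∀ x, ‖x‖ ≤ 1 → ‖T x‖ ≤ M + ‖T‖ / 2 := by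
    intro x hx
    have hmem := ht ⟨x, by simpa using hx, rfl⟩
    simp only [Set.mem_iUnion, Metric.mem_ball, Set.mem_image, exists_prop] at hmem
    obtain ⟨_, ⟨z, hz, rfl⟩, hd⟩ := hmem
    have hTq : ∀ y, T (q y) = T y := fun y => congrArg (fun S : X →L[ℂ] X => S y) hT
    have h1 : T x = T z + T (q x - q z) := by rw [map_sub, hTq, hTq]; abel
    rw [h1]
    refine (norm_add_le _ _).trans (add_le_add (hM z (htf.mem_toFinset.2 hz)) ?_)
    refine (T.le_opNorm _).trans ?_
    rw [dist_eq_norm] at hd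
    nlinarith [norm_nonneg T]
  have h0 : 0 ≤ M + ‖T‖ / 2 := (norm_nonneg _).trans (key 0 (by simp))
  have := ContinuousLinearMap.opNorm_le_of_unit_norm h0 fun x hx => key x hx.le
  linarith

theorem StrongDual.exists_half_norm_le_re (r : StrongDual ℂ X) :
    ∃ y, ‖y‖ ≤ 1 ∧ ‖r‖ / 2 ≤ (r y).re := by
  rcases eq_or_ne r 0 with rfl | hr
  · exact ⟨0, by simp⟩
  · obtain ⟨y, hy, hlt⟩ := r.exists_lt_apply_of_lt_opNorm (half_lt_self (norm_pos_iff.2 hr))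
    obtain ⟨c, hc, hcy⟩ := RCLike.exists_norm_eq_mul_self (r y)
    refine ⟨c • y, by rw [norm_smul, hc, one_mul]; exact hy.le, ?_⟩
    rw [map_smul, smul_eq_mul, ← hcy]
    simpa using hlt.le

/-- The dual of a sup norm is an `ℓ¹` norm; the factor `2` pays for using vectors that only
half-norm each component. -/
theorem ContinuousLinearMap.sum_norm_comp_single_le {κ : Type*} [Fintype κ] [DecidableEq κ]
    (Λ : (κ → X) →L[ℂ] ℂ) :
    ∑ l, ‖Λ.comp (ContinuousLinearMap.single ℂ (fun _ : κ => X) l)‖ ≤ 2 * ‖Λ‖ := by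
  choose y hy hyr using fun l =>
    StrongDual.exists_half_norm_le_re (Λ.comp (ContinuousLinearMap.single ℂ (fun _ : κ => X) l))
  have h1 : Λ y = ∑ l, (Λ.comp (ContinuousLinearMap.single ℂ (fun _ : κ => X) l)) (y l) := by
    conv_lhs => rw [← Finset.univ_sum_single y]
    simp
  have h2 : ‖y‖ ≤ 1 := (pi_norm_le_iff_of_nonneg zero_le_one).2 hy
  have h3 : ∑ l, ‖Λ.comp (ContinuousLinearMap.single ℂ (fun _ : κ => X) l)‖ / 2 ≤ (Λ y).re := by
    rw [h1, Complex.re_sum]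
    exact Finset.sum_le_sum fun l _ => hyr l
  rw [← Finset.sum_div] at h3
  have h4 : (Λ y).re ≤ ‖Λ‖ :=
    (Complex.re_le_norm _).trans ((Λ.le_opNorm y).trans (mul_le_of_le_one_right (norm_nonneg _) h2))
  linarith

/-- The estimate makes `τ` factor through the range of `j`, even if `j` is not injective;
Hahn–Banach extends the result. -/
theorem LinearMap.exists_strongDual_comp_eq {E : Type*} [AddCommGroup E] [Module ℂ E]
    (τ : E →ₗ[ℂ] ℂ) (j : E →ₗ[ℂ] Z) {β : ℝ} (hβ : 0 ≤ β) (h : ∀ v, ‖τ v‖ ≤ β * ‖j v‖) :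
    ∃ Λ : StrongDual ℂ Z, (∀ v, Λ (j v) = τ v) ∧ ‖Λ‖ ≤ β := by
  have hd : DenseRange j.rangeRestrict := j.surjective_rangeRestrict.denseRange
  obtain ⟨Λ, hΛ, hn⟩ := exists_extension_norm_eq _ (τ.extendOfNorm j.rangeRestrict)
  refine ⟨Λ, fun v => ?_, hn.trans_le (LinearMap.opNorm_extendOfNorm_le hd hβ h)⟩
  rw [← LinearMap.extendOfNorm_eq hd ⟨β, h⟩ v, ← hΛ]
  rfl

theorem exists_eq_sum_smul_of_finiteRank {T : X →L[ℂ] X} (hT : T ∈ finiteRankOperators X) :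
    ∃ (k : ℕ) (f : Fin k → StrongDual ℂ X) (x : Fin k → X), ∀ v, T v = ∑ i, f i v • x i := by
  have hfin : FiniteDimensional ℂ (LinearMap.range (T : X →ₗ[ℂ] X)) := hT
  let b := Module.finBasis ℂ (LinearMap.range (T : X →ₗ[ℂ] X))
  let T' : X →L[ℂ] LinearMap.range (T : X →ₗ[ℂ] X) := T.codRestrict _ fun x => ⟨x, rfl⟩
  refine ⟨_, fun i => (LinearMap.toContinuousLinearMap (b.coord i)).comp T', fun i => (b i : X),
    fun v => ?_⟩
  have h := congrArg Subtype.val (b.sum_repr (T' v))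
  rw [Submodule.coe_sum] at h
  exact h.symm

theorem StrongDual.exists_sum_pi_prod {ι : Type*} [Fintype ι] [DecidableEq ι]
    (Λ : StrongDual ℂ ((ι → X) × (ι → Z))) :
    ∃ (g : ι → StrongDual ℂ X) (ψ : ι → StrongDual ℂ Z),
      ∀ v w, Λ (v, w) = ∑ i, g i (v i) + ∑ i, ψ i (w i) := by
  refine ⟨fun i => (Λ.comp (ContinuousLinearMap.inl ℂ _ _)).comp
    (ContinuousLinearMap.single ℂ (fun _ => X) i), fun i =>
    (Λ.comp (ContinuousLinearMap.inr ℂ _ _)).comp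
      (ContinuousLinearMap.single ℂ (fun _ => Z) i), fun v w => ?_⟩
  have e : (v, w) = ∑ i, ContinuousLinearMap.inl ℂ (ι → X) (ι → Z) (Pi.single i (v i)) +
      ∑ i, ContinuousLinearMap.inr ℂ (ι → X) (ι → Z) (Pi.single i (w i)) := by
    rw [← map_sum, ← map_sum, Finset.univ_sum_single, Finset.univ_sum_single]
    simp
  rw [e, map_add, map_sum, map_sum]
  rfl

theorem LinearMap.norm_le_of_re_lt_on_ball (τ : Z →ₗ[ℂ] ℂ) (F : Submodule ℂ Z) {R u : ℝ}
    (hR : 0 < R) (h : ∀ T ∈ F, ‖T‖ ≤ R → (τ T).re < u) {T : Z} (hT : T ∈ F) :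
    ‖τ T‖ ≤ u / R * ‖T‖ := by
  rcases eq_or_ne T 0 with rfl | hT0
  · simp
  have hTn : 0 < ‖T‖ := norm_pos_iff.2 hT0
  obtain ⟨c, hc, hcT⟩ := RCLike.exists_norm_eq_mul_self (τ T)
  have h1 := h (((R / ‖T‖ : ℝ) : ℂ) • c • T) (F.smul_mem _ (F.smul_mem c hT)) (by
    rw [norm_smul, norm_smul, hc, one_mul, Complex.norm_real, Real.norm_of_nonneg (by positivity),
      div_mul_cancel₀ _ hTn.ne'])
  rw [map_smul, map_smul, smul_eq_mul, smul_eq_mul, ← hcT] at h1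
  have h2 : R / ‖T‖ * ‖τ T‖ < u := by
    rwa [RCLike.ofReal_eq_complex_ofReal, ← Complex.ofReal_mul, Complex.ofReal_re] at h1
  rw [div_mul_eq_mul_div, div_lt_iff₀ hTn] at h2
  rw [div_mul_eq_mul_div, le_div_iff₀ hR]
  linarith

/-- A bound for a functional on finite-rank operators on `X` of the form
`T ↦ ∑ gᵢ(T xᵢ) + ∑ ψᵢ(fᵢ ∘ T)` transfers to its extension to finite-rank operators
on the dual of `X`. -/
theorem norm_sum_dual_finiteRank_le {ι : Type*} [Fintype ι] (x : ι → X) (f g : ι → StrongDual ℂ X)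
    (ψ : ι → StrongDual ℂ (StrongDual ℂ X)) {α : ℝ} (hα : 0 ≤ α)
    (h : ∀ T ∈ finiteRankOperators X,
      ‖∑ i, g i (T (x i)) + ∑ i, ψ i ((f i).comp T)‖ ≤ α * ‖T‖)
    {U : StrongDual ℂ X →L[ℂ] StrongDual ℂ X} (hU : U ∈ finiteRankOperators (StrongDual ℂ X)) :
    ‖∑ i, U (g i) (x i) + ∑ i, ψ i (U (f i))‖ ≤ 4 * α * ‖U‖ := by
  classical
  obtain ⟨m, φ, hb, hUφ⟩ := exists_eq_sum_smul_of_finiteRank hU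
  -- With `U = ∑ φ k ⊗ hb k`, operators satisfying `T q = T` include every rank-one `hb k ⊗ y`, and
  -- finitely many points `s` control their norms.
  obtain ⟨q, hqF, -, hq⟩ := exists_finiteRank_right_unit (ContinuousLinearMap.pi hb)
  have hbq : ∀ k y, hb k (q y) = hb k y := fun k y => congrFun (hq y) k
  obtain ⟨s, hs1, hs⟩ := exists_finset_norming_of_finiteRank hqF
  let E : Submodule ℂ (X →L[ℂ] X) :=
    { carrier := {T | T * q = T}
      add_mem' := fun {S T} hS hT => by
        simp only [Set.mem_ofPred_eq] at *; rw [add_mul, hS, hT]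
      zero_mem' := zero_mul q
      smul_mem' := fun c T hT => by
        simp only [Set.mem_ofPred_eq] at *; rw [smul_mul_assoc, hT] }
  let τ : (X →L[ℂ] X) →ₗ[ℂ] ℂ :=
    { toFun := fun T => ∑ i, g i (T (x i)) + ∑ i, ψ i ((f i).comp T)
      map_add' := fun S T => by
        simp only [_root_.add_apply, map_add, ContinuousLinearMap.comp_add,
          Finset.sum_add_distrib]
        ring
      map_smul' := fun c T => by
        simp [Finset.mul_sum, mul_add] }
  let j : (X →L[ℂ] X) →ₗ[ℂ] s → X :=
    { toFun := fun T l => T l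
      map_add' := fun S T => rfl
      map_smul' := fun c T => rfl }
  obtain ⟨Λ, hΛ, hΛn⟩ := LinearMap.exists_strongDual_comp_eq (τ ∘ₗ E.subtype) (j ∘ₗ E.subtype)
    (β := 2 * α) (by positivity) (by
      rintro ⟨T, hT⟩
      have hT' : T * q = T := hT
      have hTF : T ∈ finiteRankOperators X := hT' ▸ mul_mem_finiteRankOperators_right hqF T
      refine (h T hTF).trans ?_
      have : ‖T‖ ≤ 2 * ‖j T‖ := hs T hT' _ fun z hz => norm_le_pi_norm (j T) ⟨z, hz⟩
      change _ ≤ 2 * α * ‖j T‖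
      nlinarith)
  let r : s → StrongDual ℂ X := fun l => Λ.comp (ContinuousLinearMap.single ℂ (fun _ : s => X) l)
  have hr : ∑ l, ‖r l‖ ≤ 4 * α := (Λ.sum_norm_comp_single_le).trans (by linarith)
  have hτ : ∀ T, T * q = T → τ T = ∑ l, r l (T l) := by
    intro T hT
    rw [← show Λ (j T) = τ T from hΛ ⟨T, hT⟩]
    conv_lhs => rw [← Finset.univ_sum_single (j T)]
    simp [r, j]
  -- Testing the representation of `τ` on `hb k ⊗ y` for all `y` yields an identity in the dual of
  -- `X`, to which `φ k` can be applied. Summing over `k` turns the extended functional into `∑ U (r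
  -- l) l`.
  have hid : ∀ k, ∑ i, hb k (x i) • g i + ∑ i, ψ i (hb k) • f i = ∑ l : s, hb k l • r l := by
    intro k
    ext y
    have := hτ ((hb k).smulRight y) (by ext z; simp [hbq])
    have e : ∀ i, (f i).comp ((hb k).smulRight y) = f i y • hb k := fun i => by
      ext z; simp [mul_comm]
    simp only [τ, LinearMap.coe_mk, AddHom.coe_mk, e] at this
    simpa [mul_comm] using this
  have hfinal : ∑ i, U (g i) (x i) + ∑ i, ψ i (U (f i)) = ∑ l : s, U (r l) l := by
    have h1 : ∑ i, U (g i) (x i) + ∑ i, ψ i (U (f i)) =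
        ∑ k, φ k (∑ i, hb k (x i) • g i + ∑ i, ψ i (hb k) • f i) := by
      simp only [hUφ, map_add, map_sum, map_smul, Finset.sum_add_distrib,
        _root_.sum_apply, _root_.smul_apply, smul_eq_mul]
      rw [Finset.sum_comm (s := Finset.univ (α := ι)), Finset.sum_comm (s := Finset.univ (α := ι))]
      simp only [mul_comm]
    rw [h1]
    simp only [hid, hUφ, map_sum, map_smul, _root_.sum_apply,
      _root_.smul_apply, smul_eq_mul]
    rw [Finset.sum_comm]
    simp only [mul_comm]
  rw [hfinal]
  calc ‖∑ l : s, U (r l) l‖ ≤ ∑ l : s, ‖U‖ * ‖r l‖ := by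
        refine norm_sum_le_of_le _ fun l _ => ?_
        refine ((U (r l)).le_opNorm _).trans ?_
        exact (mul_le_of_le_one_right (norm_nonneg _) (hs1 _ l.2)).trans (U.le_opNorm _)
    _ = ‖U‖ * ∑ l : s, ‖r l‖ := by rw [Finset.mul_sum]
    _ ≤ 4 * α * ‖U‖ := by nlinarith [norm_nonneg U]

/-- If the dual of `X` has the bounded approximation property, then uniformly bounded finite-rank
operators simultaneously approximate the identity at finitely many points of `X` and, through
their adjoints, at finitely many points of the dual. -/
theorem HasBoundedApproximationProperty.exists_finiteRank_approx
    (hX : HasBoundedApproximationProperty (StrongDual ℂ X)) :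
    ∃ C : ℝ, ∀ (k : ℕ) (x : Fin k → X) (f : Fin k → StrongDual ℂ X), ∀ ε > (0 : ℝ),
      ∃ T ∈ finiteRankOperators X, ‖T‖ ≤ C ∧
        ∀ i, ‖T (x i) - x i‖ < ε ∧ ‖(f i).comp T - f i‖ < ε := by
  obtain ⟨C₀, hC₀⟩ := hX
  set C := max C₀ 1 with hC
  have hC1 : 1 ≤ C := le_max_right _ _
  refine ⟨4 * C, fun k x f ε hε => ?_⟩
  let j : (X →L[ℂ] X) →ₗ[ℂ] (Fin k → X) × (Fin k → StrongDual ℂ X) :=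
    { toFun := fun T => (fun i => T (x i), fun i => (f i).comp T)
      map_add' := fun S T => by ext <;> simp
      map_smul' := fun c T => by ext <;> simp }
  let B : Set (X →L[ℂ] X) := {T | T ∈ finiteRankOperators X ∧ ‖T‖ ≤ 4 * C}
  have hB : Convex ℝ B := by
    intro S hS T hT a b ha hb hab
    refine ⟨?_, ?_⟩
    · exact add_mem (SMulMemClass.smul_mem (a : ℂ) hS.1) (SMulMemClass.smul_mem (b : ℂ) hT.1)
    · exact mem_closedBall_zero_iff.1 ((convex_closedBall (0 : X →L[ℂ] X) (4 * C))
        (mem_closedBall_zero_iff.2 hS.2) (mem_closedBall_zero_iff.2 hT.2) ha hb hab)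
  suffices hmem : (x, f) ∈ closure (j '' B) by
    obtain ⟨_, ⟨T, hT, rfl⟩, hd⟩ := Metric.mem_closure_iff.1 hmem ε hε
    rw [dist_comm, dist_eq_norm, Prod.norm_def, max_lt_iff] at hd
    refine ⟨T, hT.1, hT.2, fun i => ⟨?_, ?_⟩⟩
    · exact (norm_le_pi_norm (j T - (x, f)).1 i).trans_lt hd.1
    · exact (norm_le_pi_norm (j T - (x, f)).2 i).trans_lt hd.2
  -- A separating functional would be at most `u` in real part on the images of bounded finite-rank
  -- operators on `X`. Its transfer to `U` on the dual stays bounded by `u`, yet nearly equals its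
  -- value at `(x, f)`, whose real part exceeds `u`. The `4` in the radius `4 * C` cancels the
  -- transfer constant.
  by_contra hnot
  obtain ⟨Λ, u, hΛ, hu⟩ := RCLike.geometric_hahn_banach_closed_point (𝕜 := ℂ)
    (hB.linear_image (j.restrictScalars ℝ)).closure isClosed_closure hnot
  obtain ⟨g, ψ, hΛd⟩ := Λ.exists_sum_pi_prod
  have hu0 : 0 < u := by
    simpa using hΛ _ (subset_closure ⟨0, ⟨(finiteRankOperators X).zero_mem, by simp; linarith⟩, map_zero j⟩)
  have hbound : ∀ T ∈ finiteRankOperators X,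
      ‖∑ i, g i (T (x i)) + ∑ i, ψ i ((f i).comp T)‖ ≤ u / (4 * C) * ‖T‖ := by
    intro T hT
    rw [← hΛd]
    exact ((Λ : _ →ₗ[ℂ] ℂ) ∘ₗ j).norm_le_of_re_lt_on_ball (finiteRankOperators X).toSubmodule
      (by positivity) (fun S hS hSn => hΛ _ (subset_closure ⟨S, ⟨hS, hSn⟩, rfl⟩)) hT
  -- The `+ 1` makes the total error strictly smaller than the separation gap.
  set δ := (Complex.re (Λ (x, f)) - u) / (∑ i, ‖x i‖ + ∑ i, ‖ψ i‖ + 1) with hδ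
  have hu' : u < (Λ (x, f)).re := hu
  have hden : 0 < ∑ i, ‖x i‖ + ∑ i, ‖ψ i‖ + 1 := by positivity
  have hδ0 : 0 < δ := div_pos (by linarith) hden
  obtain ⟨U, hUF, hUn, hU⟩ := hC₀ (Set.range g ∪ Set.range f)
    ((Set.finite_range g).union (Set.finite_range f)).isCompact δ hδ0
  have h1 := norm_sum_dual_finiteRank_le x f g ψ (by positivity) hbound hUF
  have h2 : ‖∑ i, U (g i) (x i) + ∑ i, ψ i (U (f i))‖ ≤ u := by
    refine h1.trans ?_
    have : ‖U‖ ≤ C := hUn.trans (le_max_left _ _)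
    calc 4 * (u / (4 * C)) * ‖U‖ ≤ 4 * (u / (4 * C)) * C := by gcongr
      _ = u := by field_simp
  have h3 : ‖(∑ i, U (g i) (x i) + ∑ i, ψ i (U (f i))) - Λ (x, f)‖ ≤
      δ * (∑ i, ‖x i‖ + ∑ i, ‖ψ i‖) := by
    have e : (∑ i, U (g i) (x i) + ∑ i, ψ i (U (f i))) - Λ (x, f) =
        ∑ i, (U (g i) - g i) (x i) + ∑ i, ψ i (U (f i) - f i) := by
      rw [hΛd]
      simp only [_root_.sub_apply, map_sub, Finset.sum_sub_distrib]
      ring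
    rw [e, mul_add, Finset.mul_sum, Finset.mul_sum]
    refine (norm_add_le _ _).trans (add_le_add ?_ ?_)
    · refine norm_sum_le_of_le _ fun i _ => ((U (g i) - g i).le_opNorm _).trans ?_
      gcongr
      exact (hU _ (Or.inl ⟨i, rfl⟩)).le
    · refine norm_sum_le_of_le _ fun i _ => ((ψ i).le_opNorm _).trans ?_
      rw [mul_comm]
      gcongr
      exact (hU _ (Or.inr ⟨i, rfl⟩)).le
  have h4 : (Λ (x, f)).re - u = δ * (∑ i, ‖x i‖ + ∑ i, ‖ψ i‖) + δ := by
    rw [hδ]; field_simp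
  have h5 := Complex.re_le_norm (Λ (x, f))
  have h6 := norm_sub_norm_le (Λ (x, f)) (∑ i, U (g i) (x i) + ∑ i, ψ i (U (f i)))
  rw [norm_sub_rev] at h6
  linarith

/-- If the dual of `X` has the bounded approximation property, then the algebra of finite-rank
operators on `X` has uniformly bounded exact local units. -/
theorem HasBoundedApproximationProperty.exists_bounded_local_unit
    (hX : HasBoundedApproximationProperty (StrongDual ℂ X)) :
    ∃ K : ℝ, ∀ T ∈ finiteRankOperators X,
      ∃ e ∈ finiteRankOperators X, ‖e‖ ≤ K ∧ e * T = T ∧ T * e = T := by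
  obtain ⟨C, hC⟩ := hX.exists_finiteRank_approx
  refine ⟨(C + 1) + (C + 1) + (C + 1) * (C + 1), fun T hT => ?_⟩
  obtain ⟨p, hpF, -, hp⟩ := exists_finiteRank_idempotent_unit (fun _ : Unit => T) fun _ => hT
  obtain ⟨hpT, hTp⟩ := hp ()
  obtain ⟨m, f, x, hpx⟩ := exists_eq_sum_smul_of_finiteRank hpF
  set ε : ℝ := 1 / (∑ i, ‖x i‖ + ∑ i, ‖f i‖ + 1) with hε
  have hx0 : 0 ≤ ∑ i, ‖x i‖ := by positivity
  have hf0 : 0 ≤ ∑ i, ‖f i‖ := by positivity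
  have hε0 : 0 < ε := by positivity
  obtain ⟨S, hSF, hSn, hS⟩ := hC _ x f ε hε0
  have h1 : ‖(1 - S) * p‖ ≤ 1 := by
    have e : (1 - S) * p = ∑ i, (f i).smulRight (x i - S (x i)) := by
      ext v
      simp [hpx, smul_sub, Finset.sum_sub_distrib]
    rw [e]
    calc _ ≤ ∑ i, ‖f i‖ * ε := by
          refine norm_sum_le_of_le _ fun i _ => ?_
          rw [ContinuousLinearMap.norm_smulRight_apply, norm_sub_rev]
          gcongr
          exact (hS i).1.le
      _ = (∑ i, ‖f i‖) / (∑ i, ‖x i‖ + ∑ i, ‖f i‖ + 1) := by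
          rw [← Finset.sum_mul, hε, mul_one_div]
      _ ≤ 1 := div_le_one_of_le₀ (by linarith) (by positivity)
  have h2 : ‖p * (1 - S)‖ ≤ 1 := by
    have e : p * (1 - S) = ∑ i, (f i - (f i).comp S).smulRight (x i) := by
      ext v
      simp [hpx, sub_smul, Finset.sum_sub_distrib]
    rw [e]
    calc _ ≤ ∑ i, ε * ‖x i‖ := by
          refine norm_sum_le_of_le _ fun i _ => ?_
          rw [ContinuousLinearMap.norm_smulRight_apply, norm_sub_rev]
          gcongr
          exact (hS i).2.le
      _ = (∑ i, ‖x i‖) / (∑ i, ‖x i‖ + ∑ i, ‖f i‖ + 1) := by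
          rw [← Finset.mul_sum, hε, one_div_mul_eq_div]
      _ ≤ 1 := div_le_one_of_le₀ (by linarith) (by positivity)
  -- The corrections make the approximate units exact: `1 - a = (1 - S)(1 - p)` and `1 - c = (1 -
  -- p)(1 - S)`. They are small because `S` almost fixes the vectors and functionals composing `p`.
  -- Below, `a + c - c a` combines the left unit `a` and the right unit `c`.
  set a := S + (1 - S) * p with ha
  set c := S + p * (1 - S) with hc
  have haF : a ∈ finiteRankOperators X := add_mem hSF (mul_mem_finiteRankOperators_right hpF _)
  have hcF : c ∈ finiteRankOperators X := add_mem hSF (mul_mem_finiteRankOperators_left hpF _)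
  have han : ‖a‖ ≤ C + 1 := (norm_add_le _ _).trans (add_le_add hSn h1)
  have hcn : ‖c‖ ≤ C + 1 := (norm_add_le _ _).trans (add_le_add hSn h2)
  have haT : a * T = T := by rw [ha, add_mul, mul_assoc, hpT, sub_mul, one_mul]; abel
  have hTc : T * c = T := by rw [hc, mul_add, ← mul_assoc, hTp, mul_sub, mul_one]; abel
  refine ⟨a + c - c * a, sub_mem (add_mem haF hcF) (mul_mem hcF haF), ?_, ?_, ?_⟩
  · refine (norm_sub_le _ _).trans (add_le_add ((norm_add_le _ _).trans (add_le_add han hcn)) ?_)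
    exact (norm_mul_le _ _).trans (mul_le_mul hcn han (norm_nonneg _) ((norm_nonneg _).trans hcn))
  · rw [sub_mul, add_mul, mul_assoc, haT]; abel
  · rw [mul_sub, mul_add, ← mul_assoc, hTc]; abel

end ApproximateUnits

/-! ### From finite-rank operators to the continuous representation -/

section Representation

variable {X Y : Type*} [NormedAddCommGroup X] [NormedSpace ℂ X] [NormedAddCommGroup Y]
  [NormedSpace ℂ Y]

/-- The finite-rank operators, as a linear subspace of the algebra of approximable operators. -/
def finiteRankSubmodule (X : Type*) [NormedAddCommGroup X] [NormedSpace ℂ X] :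
    Submodule ℂ (approximableOperators X) where
  carrier := finiteRankInApproximable X
  add_mem' := fun hS hT => (finiteRankOperators X).add_mem hS hT
  zero_mem' := (finiteRankOperators X).zero_mem
  smul_mem' := fun c _ hT => SMulMemClass.smul_mem (s := finiteRankOperators X) c hT

theorem dense_finiteRankInApproximable : Dense (finiteRankInApproximable X) := by
  rw [Subtype.dense_iff]
  intro T hT
  have h : (finiteRankOperators X : Set (X →L[ℂ] X)) ⊆
      (fun S : approximableOperators X => (S : X →L[ℂ] X)) '' finiteRankInApproximable X :=
    fun S hS => ⟨⟨S, (finiteRankOperators X).le_topologicalClosure hS⟩, hS, rfl⟩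
  exact closure_mono h hT

theorem approximablePow_mem_finiteRank {n : ℕ} (hn : 1 ≤ n) {T : approximableOperators X}
    (hT : T ∈ finiteRankInApproximable X) :
    approximablePow n hn T ∈ finiteRankInApproximable X :=
  (finiteRankOperators X).pow_mem_of_pos hT hn

theorem continuous_approximablePow {n : ℕ} (hn : 1 ≤ n) :
    Continuous (approximablePow (X := X) n hn) :=
  (continuous_subtype_val.pow n).subtype_mk _

theorem NonUnitalAlgHom.map_pow_eq_approximablePow {k : ℕ}
    (J : Matrix (Fin k) (Fin k) ℂ →ₙₐ[ℂ] approximableOperators X) {n : ℕ} (hn : 1 ≤ n)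
    (A : Matrix (Fin k) (Fin k) ℂ) : J (A ^ n) = approximablePow n hn (J A) := by
  refine Subtype.ext ?_
  change (J (A ^ n) : X →L[ℂ] X) = (J A : X →L[ℂ] X) ^ n
  induction n, hn using Nat.le_induction with
  | base => simp
  | succ m _ ih => rw [pow_succ, pow_succ, ← ih, map_mul]; rfl

theorem add_pow_of_mul_eq_zero {R : Type*} [Ring R] {a b : R} (hab : a * b = 0) (hba : b * a = 0)
    {n : ℕ} (hn : 1 ≤ n) : (a + b) ^ n = a ^ n + b ^ n := by
  induction n, hn using Nat.le_induction with
  | base => simp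
  | succ m hm ih =>
    have h1 : a ^ m * b = 0 := by
      rw [← Nat.sub_add_cancel hm, pow_succ, mul_assoc, hab, mul_zero]
    have h2 : b ^ m * a = 0 := by
      rw [← Nat.sub_add_cancel hm, pow_succ, mul_assoc, hba, mul_zero]
    rw [pow_succ, ih, add_mul, mul_add, mul_add, h1, h2, pow_succ, pow_succ, add_zero, zero_add]

theorem approximablePow_add {S T : approximableOperators X} (hST : S * T = 0) (hTS : T * S = 0)
    {n : ℕ} (hn : 1 ≤ n) :
    approximablePow n hn (S + T) = approximablePow n hn S + approximablePow n hn T :=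
  Subtype.ext (add_pow_of_mul_eq_zero (congrArg Subtype.val hST) (congrArg Subtype.val hTS) hn)

theorem MultilinearMap.diagonalDeriv_compLinearMap {V V' : Type*} [AddCommGroup V] [Module ℂ V]
    [AddCommGroup V'] [Module ℂ V'] {n : ℕ} (φ : MultilinearMap ℂ (fun _ : Fin n => V) Y)
    (J : V' →ₗ[ℂ] V) (a b : V') :
    (φ.compLinearMap fun _ => J).diagonalDeriv a b = φ.diagonalDeriv (J a) (J b) := by
  simp only [diagonalDeriv_apply, linearDeriv_apply, compLinearMap_apply]
  refine Finset.sum_congr rfl fun i _ => congrArg φ (funext fun j => ?_)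
  rcases eq_or_ne j i with rfl | h
  · simp
  · simp [h]

theorem OrthogonallyAdditiveOn.comp_matrix_embedding {n k : ℕ}
    {φ : MultilinearMap ℂ (fun _ : Fin n => approximableOperators X) Y}
    (hφ : OrthogonallyAdditiveOn (fun T => φ (fun _ => T)) (finiteRankInApproximable X))
    {J : Matrix (Fin k) (Fin k) ℂ →ₙₐ[ℂ] approximableOperators X}
    (hJ : ∀ A, J A ∈ finiteRankInApproximable X) :
    OrthogonallyAdditive fun A =>
      (φ.compLinearMap fun _ => (J : Matrix (Fin k) (Fin k) ℂ →ₗ[ℂ] approximableOperators X))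
        (fun _ => A) := by
  intro A B hAB hBA
  have := hφ (J A) (hJ A) (J B) (hJ B) (by rw [← map_mul, hAB, map_zero])
    (by rw [← map_mul, hBA, map_zero])
  simpa using this

/-- Once `T`, `e`, `e'` sit in a single matrix algebra, both sides equal the derivative at its unit.
Injectivity of the embedding pulls the absorption relations back to matrices. -/
theorem diagonalDeriv_eq_of_local_units [CompleteSpace Y] {n : ℕ} (hn : 1 ≤ n)
    {φ : MultilinearMap ℂ (fun _ : Fin n => approximableOperators X) Y}
    (hφ : OrthogonallyAdditiveOn (fun T => φ (fun _ => T)) (finiteRankInApproximable X))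
    {T e e' : approximableOperators X} (hT : T ∈ finiteRankInApproximable X)
    (he : e ∈ finiteRankInApproximable X) (he' : e' ∈ finiteRankInApproximable X)
    (heT : e * T = T) (hTe : T * e = T) (heT' : e' * T = T) (hTe' : T * e' = T) :
    φ.diagonalDeriv e T = φ.diagonalDeriv e' T := by
  obtain ⟨k, J, hJi, hJ, hJs⟩ := exists_matrix_embedding ![T, e, e'] (by
    intro i; fin_cases i <;> assumption)
  obtain ⟨S, hS⟩ := hJs 0
  obtain ⟨E, hE⟩ := hJs 1
  obtain ⟨E', hE'⟩ := hJs 2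
  simp only [Matrix.cons_val] at hS hE hE'
  subst hS hE hE'
  rw [← map_mul] at heT hTe heT' hTe'
  have h := hφ.comp_matrix_embedding hJ
  have h1 := MultilinearMap.diagonalDeriv_matrix_of_absorb hn _ h (hJi heT) (hJi hTe)
  have h2 := MultilinearMap.diagonalDeriv_matrix_of_absorb hn _ h (hJi heT') (hJi hTe')
  have h3 := h1.trans h2.symm
  rwa [MultilinearMap.diagonalDeriv_compLinearMap, MultilinearMap.diagonalDeriv_compLinearMap] at h3

theorem exists_local_unit_finiteRankInApproximable {T : approximableOperators X}
    (hT : T ∈ finiteRankInApproximable X) :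
    ∃ e ∈ finiteRankInApproximable X, e * T = T ∧ T * e = T := by
  obtain ⟨e, heF, -, he⟩ := exists_finiteRank_idempotent_unit (fun _ : Unit => (T : X →L[ℂ] X))
    fun _ => hT
  exact ⟨⟨e, (finiteRankOperators X).le_topologicalClosure heF⟩, heF, Subtype.ext (he ()).1,
    Subtype.ext (he ()).2⟩

/-- An orthogonally additive homogeneous polynomial on the finite-rank operators is linear in the
power of the operator; the linear map is computed by a derivative at any local unit. -/
theorem exists_linear_representation_finiteRank [CompleteSpace Y] {n : ℕ} (hn : 1 ≤ n)
    {φ : MultilinearMap ℂ (fun _ : Fin n => approximableOperators X) Y}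
    (hφ : OrthogonallyAdditiveOn (fun T => φ (fun _ => T)) (finiteRankInApproximable X)) :
    ∃ Ψ : finiteRankSubmodule X →ₗ[ℂ] Y,
      (∀ (T : finiteRankSubmodule X), ∀ e ∈ finiteRankInApproximable X,
        e * (T : approximableOperators X) = T → (T : approximableOperators X) * e = T →
          n • Ψ T = φ.diagonalDeriv e T) ∧
      ∀ T : finiteRankSubmodule X,
        φ (fun _ => T) = Ψ ⟨approximablePow n hn T, approximablePow_mem_finiteRank hn T.2⟩ := by
  have hn0 : (n : ℂ) ≠ 0 := Nat.cast_ne_zero.2 (by omega)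
  choose e heF heT hTe using fun T : finiteRankSubmodule X =>
    exists_local_unit_finiteRankInApproximable T.2
  have key : ∀ (T : finiteRankSubmodule X), ∀ e' ∈ finiteRankInApproximable X,
      e' * (T : approximableOperators X) = T → (T : approximableOperators X) * e' = T →
        φ.diagonalDeriv (e T) T = φ.diagonalDeriv e' T := fun T e' he' h1 h2 =>
    diagonalDeriv_eq_of_local_units hn hφ T.2 (heF T) he' (heT T) (hTe T) h1 h2
  let Ψ : finiteRankSubmodule X →ₗ[ℂ] Y :=
    { toFun := fun T => (n : ℂ)⁻¹ • φ.diagonalDeriv (e T) T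
      map_add' := fun S T => by
        -- `J 1` is a common local unit for `S`, `T` and `S + T`, and the derivative at a fixed
        -- point is linear.
        obtain ⟨k, J, -, hJ, hJs⟩ := exists_matrix_embedding
          ![(S : approximableOperators X), (T : approximableOperators X)]
          (by intro i; fin_cases i; exacts [S.2, T.2])
        obtain ⟨A, hA⟩ := hJs 0
        obtain ⟨B, hB⟩ := hJs 1
        simp only [Matrix.cons_val] at hA hB
        have hS1 : J 1 * (S : approximableOperators X) = S := by rw [← hA, ← map_mul, one_mul]
        have hS2 : (S : approximableOperators X) * J 1 = S := by rw [← hA, ← map_mul, mul_one]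
        have hT1 : J 1 * (T : approximableOperators X) = T := by rw [← hB, ← map_mul, one_mul]
        have hT2 : (T : approximableOperators X) * J 1 = T := by rw [← hB, ← map_mul, mul_one]
        rw [key S _ (hJ 1) hS1 hS2, key T _ (hJ 1) hT1 hT2,
          key (S + T) _ (hJ 1) (by rw [Submodule.coe_add, mul_add, hS1, hT1])
            (by rw [Submodule.coe_add, add_mul, hS2, hT2]), Submodule.coe_add, map_add, smul_add]
      map_smul' := fun c T => by
        rw [key (c • T) _ (heF T) (by rw [Submodule.coe_smul, mul_smul_comm, heT])
          (by rw [Submodule.coe_smul, smul_mul_assoc, hTe]), Submodule.coe_smul, map_smul,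
          smul_comm, RingHom.id_apply] }
  have hΨ : ∀ (T : finiteRankSubmodule X), ∀ e ∈ finiteRankInApproximable X,
      e * (T : approximableOperators X) = T → (T : approximableOperators X) * e = T →
        n • Ψ T = φ.diagonalDeriv e T := by
    intro T e' he' h1 h2
    rw [← key T e' he' h1 h2, ← Nat.cast_smul_eq_nsmul ℂ]
    exact smul_inv_smul₀ hn0 _
  refine ⟨Ψ, hΨ, fun T => ?_⟩
  obtain ⟨k, J, -, hJ, hJs⟩ := exists_matrix_embedding
    (fun _ : Unit => (T : approximableOperators X)) fun _ => T.2
  obtain ⟨A, hA⟩ := hJs ()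
  have h1 := MultilinearMap.nsmul_apply_matrix_eq_diagonalDeriv_pow _
    (hφ.comp_matrix_embedding hJ) A
  rw [MultilinearMap.diagonalDeriv_compLinearMap] at h1
  have hpow : approximablePow n hn (T : approximableOperators X) = J (A ^ n) := by
    rw [J.map_pow_eq_approximablePow hn, hA]
  have h2 := hΨ ⟨approximablePow n hn T, approximablePow_mem_finiteRank hn T.2⟩ (J 1) (hJ 1)
    (by
      change J 1 * approximablePow n hn _ = approximablePow n hn _
      rw [hpow, ← map_mul, one_mul]) (by
      change approximablePow n hn _ * J 1 = approximablePow n hn _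
      rw [hpow, ← map_mul, mul_one])
  have h3 : n • φ (fun _ => (T : approximableOperators X)) = φ.diagonalDeriv (J 1) (J (A ^ n)) := by
    rw [← hA]
    exact h1
  rw [← Nat.cast_smul_eq_nsmul ℂ] at h2 h3
  refine smul_right_injective Y hn0 (h3.trans (Eq.trans ?_ h2.symm))
  rw [← hpow]

/-- Continuity at `0` bounds the diagonal on a small ball; homogeneity rescales. Only the diagonal
is assumed continuous, not `φ`. -/
theorem MultilinearMap.exists_bound_diagonal_of_continuous {V : Type*} [NormedAddCommGroup V]
    [NormedSpace ℂ V] {n : ℕ} (φ : MultilinearMap ℂ (fun _ : Fin n => V) Y)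
    (hφ : Continuous fun v => φ (fun _ => v)) (r : ℝ) :
    ∃ M, ∀ v, ‖v‖ ≤ r → ‖φ (fun _ => v)‖ ≤ M := by
  have hev : ∀ᶠ v in nhds (0 : V), ‖φ (fun _ => v)‖ < ‖φ (fun _ => 0)‖ + 1 :=
    (hφ.norm.tendsto 0).eventually_lt_const (lt_add_one _)
  obtain ⟨δ, hδ, hball⟩ := Metric.eventually_nhds_iff.1 hev
  have hc : 0 < |r| / δ + 1 := by positivity
  refine ⟨(|r| / δ + 1) ^ n * (‖φ (fun _ => 0)‖ + 1), fun v hv => ?_⟩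
  set c := |r| / δ + 1 with hcdef
  have hc0 : (c : ℂ) ≠ 0 := by exact_mod_cast hc.ne'
  have hw : ‖((c : ℂ)⁻¹ • v)‖ < δ := by
    rw [norm_smul, norm_inv, Complex.norm_real, Real.norm_of_nonneg hc.le, inv_mul_lt_iff₀ hc]
    have : c * δ = |r| + δ := by rw [hcdef]; field_simp
    rw [this]
    linarith [le_abs_self r]
  have hlt := hball (y := (c : ℂ)⁻¹ • v) (by rwa [dist_zero_right])
  have e : v = (c : ℂ) • (c : ℂ)⁻¹ • v := (smul_inv_smul₀ hc0 v).symm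
  rw [e, φ.apply_diagonal_smul, norm_smul, norm_pow, Complex.norm_real,
    Real.norm_of_nonneg hc.le]
  gcongr

/-- Cauchy's estimate on the unit circle for `t ↦ φ(e + t v, …)`, uniform over `‖e‖ ≤ K`. -/
theorem MultilinearMap.exists_bound_diagonalDeriv [CompleteSpace Y] {V : Type*}
    [NormedAddCommGroup V] [NormedSpace ℂ V] {n : ℕ}
    (φ : MultilinearMap ℂ (fun _ : Fin n => V) Y) (hφ : Continuous fun v => φ (fun _ => v))
    (K : ℝ) : ∃ M, ∀ e v, ‖e‖ ≤ K → ‖φ.diagonalDeriv e v‖ ≤ M * ‖v‖ := by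
  obtain ⟨M, hM⟩ := φ.exists_bound_diagonal_of_continuous hφ (K + 1)
  have h1 : ∀ e v, ‖e‖ ≤ K → ‖v‖ ≤ 1 → ‖φ.diagonalDeriv e v‖ ≤ M := by
    intro e v he hv
    have h := Complex.norm_deriv_le_of_forall_mem_sphere_norm_le (c := 0) (R := 1) (C := M)
      one_pos (φ.differentiable_apply_add_smul e v).diffContOnCl (by
        intro z hz
        refine hM _ ((norm_add_le _ _).trans (add_le_add he ?_))
        rw [norm_smul, mem_sphere_zero_iff_norm.1 hz, one_mul]
        exact hv)
    rwa [(φ.hasDerivAt_apply_add_smul e v).deriv, div_one] at h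
  refine ⟨M, fun e v he => ?_⟩
  rcases eq_or_ne v 0 with rfl | hv
  · simp
  have hv' : (‖v‖ : ℂ) ≠ 0 := by simpa using hv
  have h2 := h1 e ((‖v‖ : ℂ)⁻¹ • v) he (by
    rw [norm_smul, norm_inv, Complex.norm_real, norm_norm,
      inv_mul_cancel₀ (norm_ne_zero_iff.2 hv)])
  rwa [map_smul, norm_smul, norm_inv, Complex.norm_real, norm_norm,
    inv_mul_le_iff₀ (norm_pos_iff.2 hv), mul_comm] at h2

/-- Differentiating the image of `(1 + t A) ^ n` at `0` recovers `n Φ(J A)`, so `n`-th powers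
determine `Φ` on the dense finite-rank part. The matrix unit stands in for the identity of `X`,
which need not be approximable. -/
theorem eq_of_apply_approximablePow_eq {n : ℕ} (hn : 1 ≤ n)
    {Φ Φ' : approximableOperators X →L[ℂ] Y}
    (h : ∀ T, Φ (approximablePow n hn T) = Φ' (approximablePow n hn T)) : Φ = Φ' := by
  refine ContinuousLinearMap.coeFn_injective
    (Continuous.ext_on dense_finiteRankInApproximable Φ.continuous Φ'.continuous fun T hT => ?_)
  obtain ⟨k, J, -, hJ, hJs⟩ := exists_matrix_embedding (fun _ : Unit => T) fun _ => hT
  obtain ⟨A, rfl⟩ := hJs ()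
  let J' : Matrix (Fin k) (Fin k) ℂ →ₗ[ℂ] approximableOperators X := J
  have h1 := ((Φ : _ →ₗ[ℂ] Y) ∘ₗ J').hasDerivAt_add_smul_pow_of_absorb (one_mul A) (mul_one A) n
  have h2 := ((Φ' : _ →ₗ[ℂ] Y) ∘ₗ J').hasDerivAt_add_smul_pow_of_absorb (one_mul A) (mul_one A) n
  have e : (fun t : ℂ => ((Φ : _ →ₗ[ℂ] Y) ∘ₗ J') ((1 + t • A) ^ n)) =
      fun t : ℂ => ((Φ' : _ →ₗ[ℂ] Y) ∘ₗ J') ((1 + t • A) ^ n) := by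
    funext t
    change Φ (J _) = Φ' (J _)
    rw [J.map_pow_eq_approximablePow hn]
    exact h _
  rw [e] at h1
  have h3 := h1.unique h2
  rw [← Nat.cast_smul_eq_nsmul ℂ, ← Nat.cast_smul_eq_nsmul ℂ] at h3
  exact smul_right_injective Y (Nat.cast_ne_zero.2 (by omega : n ≠ 0) : (n : ℂ) ≠ 0) h3

theorem LinearMap.exists_continuous_extension_of_dense [CompleteSpace Y] {V : Type*}
    [NormedAddCommGroup V] [NormedSpace ℂ V] {S : Submodule ℂ V} (hS : Dense (S : Set V))
    (Ψ : S →ₗ[ℂ] Y) (M : ℝ) (h : ∀ v : S, ‖Ψ v‖ ≤ M * ‖(v : V)‖) :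
    ∃ Φ : V →L[ℂ] Y, ∀ v : S, Φ v = Ψ v := by
  have hd : DenseRange S.subtype := by
    rw [DenseRange, Submodule.coe_subtype, Subtype.range_coe]
    exact hS
  exact ⟨Ψ.extendOfNorm S.subtype, fun v => LinearMap.extendOfNorm_eq hd ⟨M, h⟩ v⟩

theorem exists_continuous_representation [CompleteSpace Y]
    (hX : HasBoundedApproximationProperty (StrongDual ℂ X)) {n : ℕ} (hn : 1 ≤ n)
    {φ : MultilinearMap ℂ (fun _ : Fin n => approximableOperators X) Y}
    (hc : Continuous fun T => φ (fun _ => T))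
    (hφ : OrthogonallyAdditiveOn (fun T => φ (fun _ => T)) (finiteRankInApproximable X)) :
    ∃ Φ : approximableOperators X →L[ℂ] Y, ∀ T, φ (fun _ => T) = Φ (approximablePow n hn T) := by
  let _ : NormedSpace ℂ (approximableOperators X) :=
    { norm_smul_le := fun c T => norm_smul_le c (T : X →L[ℂ] X) }
  obtain ⟨K, hK⟩ := hX.exists_bounded_local_unit
  obtain ⟨Ψ, hΨ, hpow⟩ := exists_linear_representation_finiteRank hn hφ
  obtain ⟨M, hM⟩ :=
    @MultilinearMap.exists_bound_diagonalDeriv Y _ _ _ (approximableOperators X) _ _ n φ hc K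
  have hbound : ∀ T : finiteRankSubmodule X, ‖Ψ T‖ ≤ M * ‖(T : approximableOperators X)‖ := by
    intro T
    obtain ⟨e, heF, heK, heT, hTe⟩ := hK T T.2
    have h := hΨ T ⟨e, (finiteRankOperators X).le_topologicalClosure heF⟩ heF (Subtype.ext heT)
      (Subtype.ext hTe)
    refine le_trans ?_ (hM ⟨e, (finiteRankOperators X).le_topologicalClosure heF⟩ T heK)
    rw [← h, ← Nat.cast_smul_eq_nsmul ℂ, norm_smul, Complex.norm_natCast]
    exact le_mul_of_one_le_left (norm_nonneg _) (by exact_mod_cast hn)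
  obtain ⟨Φ, hΦ⟩ := @LinearMap.exists_continuous_extension_of_dense Y _ _ _
    (approximableOperators X) _ _ (finiteRankSubmodule X) dense_finiteRankInApproximable Ψ M hbound
  refine ⟨Φ, congrFun (Continuous.ext_on dense_finiteRankInApproximable hc
    (Φ.continuous.comp (continuous_approximablePow hn)) fun T hT => ?_)⟩
  exact (hpow ⟨T, hT⟩).trans
    (hΦ ⟨approximablePow n hn T, approximablePow_mem_finiteRank hn hT⟩).symm

end Representation

theorem mainTheorem1 {X Y : Type*}
    [NormedAddCommGroup X] [NormedSpace ℂ X] [CompleteSpace X]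
    [NormedAddCommGroup Y] [NormedSpace ℂ Y] [CompleteSpace Y]
    (hX : HasBoundedApproximationProperty (StrongDual ℂ X))
    (n : ℕ) (hn : 1 ≤ n) (P : approximableOperators X → Y)
    (hP : IsHomogeneousPolynomial n P) (hPc : Continuous P) :
    List.TFAE [
      OrthogonallyAdditive P,
      OrthogonallyAdditiveOn P (finiteRankInApproximable X),
      ∃! Φ : approximableOperators X →L[ℂ] Y, ∀ T, P T = Φ (approximablePow n hn T)] := by
  obtain ⟨φ, hφ⟩ := hP
  obtain rfl : P = fun T => φ (fun _ => T) := funext hφ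
  tfae_have 1 → 2 := fun h a _ b _ => h a b
  tfae_have 2 → 3 := fun h => by
    obtain ⟨Φ, hΦ⟩ := exists_continuous_representation hX hn hPc h
    exact ⟨Φ, hΦ, fun Φ' hΦ' =>
      eq_of_apply_approximablePow_eq hn fun T => (hΦ' T).symm.trans (hΦ T)⟩
  tfae_have 3 → 1 := by
    rintro ⟨Φ, hΦ, -⟩ S T hST hTS
    rw [hΦ, hΦ, hΦ, approximablePow_add hST hTS hn, map_add]
  tfae_finish
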